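/- For $\mu_1,\mu_2>0$ consider Kopel's duopoly map with best-response dynamics (adjustment coefficients $\rho_1=\rho_2=1$), i.e. the map $F:\mathbb{R}^2\to\mathbb{R}^2$, $$F(x,y)=\bigl(\mu_1\,y(1-y),\ \mu_2\,x(1-x)\bigr).$$ A positive equilibrium is a fixed point $(x^*,y^*)$ of $F$ with $x^*>0$ and $y^*>0$. It is called stable if it is locally asymptotically stable under iteration of $F$ (orbits starting close enough to it stay arbitrarily close to it, and all orbits starting in some neighbourhood of it converge to it). It satisfies the Jury conditions if the Jacobian matrix $J=\begin{pmatrix}0&\mu_1(1-2y^*)\\ \mu_2(1-2x^*)&0\end{pmatrix}$ has $1-\operatorname{Tr}J+\det J>0$, $1+\operatorname{Tr}J+\det J>0$ and $1-\det J>0$. Put $$\begin{aligned} R_1&=\mu_1^2\mu_2^2-4\mu_1^2\mu_2-4\mu_1\mu_2^2+18\mu_1\mu_2-27,\\ S_3&=\mu_1^3\mu_2^3-4\mu_1^3\mu_2^2-4\mu_1^2\mu_2^3+15\mu_1^2\mu_2^2+12\mu_1^2\mu_2+12\mu_1\mu_2^2-85\mu_1\mu_2+125,\\ A_1&=\mu_1\mu_2-15,\\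 A_2&=\mu_1^2\mu_2^2-4\mu_1^2\mu_2-5\mu_1\mu_2^2+21\mu_1\mu_2+11\mu_2-60. \end{aligned}$$ (a) If $R_1>0$, $S_3>0$, $A_1<0$ and $A_2>0$, then there are exactly two stable positive equilibria. (b) If $\mu_1\mu_2>1$ and either ($R_1<0$ and $S_3>0$) or ($R_1>0$ and $S_3<0$), then there is exactly one stable positive equilibrium. Moreover, in both cases, the stable positive equilibria are precisely the positive equilibria that satisfy the Jury conditions. -/

import Mathlib

open Filter Topology

noncomputable section

/-- Kopel's duopoly map on the plane, with adjustment coefficients `ρ₁, ρ₂` and externality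
intensities `μ₁, μ₂`. -/
def kopelMap (ρ₁ ρ₂ μ₁ μ₂ : ℝ) (p : ℝ × ℝ) : ℝ × ℝ :=
  ((1 - ρ₁) * p.1 + ρ₁ * μ₁ * p.2 * (1 - p.2),
   (1 - ρ₂) * p.2 + ρ₂ * μ₂ * p.1 * (1 - p.1))

/-- A positive equilibrium of Kopel's map: a fixed point with both coordinates positive. -/
def IsPositiveEquilibrium (ρ₁ ρ₂ μ₁ μ₂ : ℝ) (p : ℝ × ℝ) : Prop :=
  kopelMap ρ₁ ρ₂ μ₁ μ₂ p = p ∧ 0 < p.1 ∧ 0 < p.2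

/-- Local asymptotic stability of the point `p` under iteration of `f`: orbits that start close
enough to `p` stay as close to `p` as desired (Lyapunov stability), and all orbits that start in
some neighbourhood of `p` converge to `p`. -/
def IsLocallyStable {X : Type*} [TopologicalSpace X] (f : X → X) (p : X) : Prop :=
  (∀ U ∈ 𝓝 p, ∃ V ∈ 𝓝 p, ∀ q ∈ V, ∀ n : ℕ, f^[n] q ∈ U) ∧
    ∃ V ∈ 𝓝 p, ∀ q ∈ V, Tendsto (fun n : ℕ => f^[n] q) atTop (𝓝 p)

/-- The set of locally asymptotically stable positive equilibria of Kopel's map. -/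
def stablePositiveEquilibria (ρ₁ ρ₂ μ₁ μ₂ : ℝ) : Set (ℝ × ℝ) :=
  {p | IsPositiveEquilibrium ρ₁ ρ₂ μ₁ μ₂ p ∧ IsLocallyStable (kopelMap ρ₁ ρ₂ μ₁ μ₂) p}

/-- The Jacobian matrix of Kopel's map. -/
def kopelJacobian (ρ₁ ρ₂ μ₁ μ₂ : ℝ) (p : ℝ × ℝ) : Matrix (Fin 2) (Fin 2) ℝ :=
  !![1 - ρ₁, μ₁ * ρ₁ * (1 - 2 * p.2); μ₂ * ρ₂ * (1 - 2 * p.1), 1 - ρ₂]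

/-- The Jury conditions for a real `2 × 2` matrix. -/
def JuryConditions (J : Matrix (Fin 2) (Fin 2) ℝ) : Prop :=
  0 < 1 - J.trace + J.det ∧ 0 < 1 + J.trace + J.det ∧ 0 < 1 - J.det

/-- The set of positive equilibria of Kopel's map whose Jacobian meets the Jury conditions. -/
def juryPositiveEquilibria (ρ₁ ρ₂ μ₁ μ₂ : ℝ) : Set (ℝ × ℝ) :=
  {p | IsPositiveEquilibrium ρ₁ ρ₂ μ₁ μ₂ p ∧ JuryConditions (kopelJacobian ρ₁ ρ₂ μ₁ μ₂ p)}

def polyR₁ (μ₁ μ₂ : ℝ) : ℝ :=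
  μ₁ ^ 2 * μ₂ ^ 2 - 4 * μ₁ ^ 2 * μ₂ - 4 * μ₁ * μ₂ ^ 2 + 18 * μ₁ * μ₂ - 27

def polyS₃ (μ₁ μ₂ : ℝ) : ℝ :=
  μ₁ ^ 3 * μ₂ ^ 3 - 4 * μ₁ ^ 3 * μ₂ ^ 2 - 4 * μ₁ ^ 2 * μ₂ ^ 3 + 15 * μ₁ ^ 2 * μ₂ ^ 2
    + 12 * μ₁ ^ 2 * μ₂ + 12 * μ₁ * μ₂ ^ 2 - 85 * μ₁ * μ₂ + 125

def polyA₁ (μ₁ μ₂ : ℝ) : ℝ := μ₁ * μ₂ - 15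

def polyA₂ (μ₁ μ₂ : ℝ) : ℝ :=
  μ₁ ^ 2 * μ₂ ^ 2 - 4 * μ₁ ^ 2 * μ₂ - 5 * μ₁ * μ₂ ^ 2 + 21 * μ₁ * μ₂ + 11 * μ₂ - 60

end

/-! Write m, n for μ₁, μ₂. Eliminating y turns positive equilibria into roots of a cubic, all of
them in (0,1) when mn > 1. At a root x let t(x) = `kopelMultiplier m n x`. The Jacobian has zero
trace and determinant -t, so the Jury conditions say |t| < 1. This implies stability, and |t| > 1
excludes it (`stable_eq_jury`). It remains to count roots with |t| < 1 and to rule out |t| = 1.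

For roots a, b, c one has 1 - t(a) = mn²a(a-b)(a-c). Hence t < 1 at the outer of three distinct
roots and t > 1 at the middle one, and only the sign of 1 + t at the outer roots is in doubt. R₁ is
the discriminant up to a positive factor, S₃ the product of the weights 1 + t over the roots, -A₁
their sum, and A₂ a positive multiple of a minor of the Hermite form with these weights. If R₁ > 0,
the sign of S₃ tells whether the outer weights have equal signs; A₁ < 0 and A₂ > 0 exclude that both
are negative. If R₁ < 0, the root is unique and 1 + t there has the sign of S₃, the complex pair
contributing a squared modulus. -/

/-- The cubic whose roots are the nonzero abscissae of the fixed points of Kopel's map with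
best-response dynamics. -/
def kopelCubic (m n x : ℝ) : ℝ := m * n * (1 - x) * (1 - n * x * (1 - x)) - 1

/-- The determinant of the Jacobian up to sign: the derivative of the second iterate at the
fixed point with abscissa `x`. -/
def kopelMultiplier (m n x : ℝ) : ℝ := m * n * (1 - 2 * x) * (1 - 2 * (n * x * (1 - x)))

/-- For x ≥ 1 the product is nonpositive, so the cubic is at most -1; for x ≤ 0 both 1 - x and 1 -
nx(1 - x) are at least 1, so it is at least mn - 1 > 0. -/
theorem kopelCubic_root_mem_Ioo {m n x : ℝ} (hn : 0 < n) (hmn : 1 < m * n)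
    (hx : kopelCubic m n x = 0) : 0 < x ∧ x < 1 := by
  unfold kopelCubic at hx
  have hx1 : x < 1 := by
    by_contra! h
    have h1 : 0 ≤ n * x * (x - 1) := by
      have : 0 ≤ x - 1 := by linarith
      have : 0 ≤ x := by linarith
      positivity
    have h2 : 0 ≤ (m * n) * (x - 1) * (1 + n * x * (x - 1)) := by
      have : 0 ≤ x - 1 := by linarith
      positivity
    nlinarith
  refine ⟨?_, hx1⟩
  by_contra! h
  have h1 : 0 ≤ n * (-x) * (1 - x) := by
    have : 0 ≤ 1 - x := by linarith
    have : 0 ≤ -x := by linarith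
    positivity
  have h3 : 1 ≤ (1 - x) * (1 + n * (-x) * (1 - x)) := by nlinarith
  nlinarith

theorem exists_kopelCubic_root {m n : ℝ} (hmn : 1 < m * n) : ∃ r, kopelCubic m n r = 0 := by
  have hc : ContinuousOn (kopelCubic m n) (Set.Icc 0 1) := by
    unfold kopelCubic; fun_prop
  have := intermediate_value_Icc' zero_le_one hc
  obtain ⟨r, -, hr⟩ := this (show (0 : ℝ) ∈ Set.Icc _ _ by
    constructor <;> norm_num [kopelCubic]; linarith)
  exact ⟨r, hr⟩

theorem isPositiveEquilibrium_one_iff {m n : ℝ} (hn : 0 < n) (hmn : 1 < m * n) (p : ℝ × ℝ) :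
    IsPositiveEquilibrium 1 1 m n p ↔
      kopelCubic m n p.1 = 0 ∧ p.2 = n * p.1 * (1 - p.1) := by
  obtain ⟨x, y⟩ := p
  simp only [IsPositiveEquilibrium, kopelMap, Prod.mk.injEq]
  constructor
  · rintro ⟨⟨h1, h2⟩, hx, hy⟩
    have hy' : y = n * x * (1 - x) := by linarith
    refine ⟨?_, hy'⟩
    subst hy'
    have : x * kopelCubic m n x = 0 := by
      unfold kopelCubic; linear_combination h1
    exact (mul_eq_zero.mp this).resolve_left hx.ne'
  · rintro ⟨h, rfl⟩
    obtain ⟨h0, h1⟩ := kopelCubic_root_mem_Ioo hn hmn h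
    have : 0 < 1 - x := by linarith
    refine ⟨⟨?_, by ring⟩, h0, by positivity⟩
    unfold kopelCubic at h
    linear_combination x * h

/-- With zero trace the first two Jury conditions coincide; they bound the multiplier above by 1,
and the third bounds it below by -1. -/
theorem juryConditions_one_iff (m n : ℝ) (p : ℝ × ℝ) :
    JuryConditions (kopelJacobian 1 1 m n p) ↔
      |m * n * (1 - 2 * p.1) * (1 - 2 * p.2)| < 1 := by
  simp only [JuryConditions, kopelJacobian, Matrix.det_fin_two_of, Matrix.trace_fin_two_of, abs_lt]
  constructor
  · rintro ⟨h1, h2, h3⟩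
    constructor <;> linarith
  · rintro ⟨h1, h2⟩
    refine ⟨?_, ?_, ?_⟩ <;> linarith

/-! ### Stability criteria -/

/-- A map that contracts, near `p`, a continuous gauge whose small sublevel sets form a
neighbourhood basis of `p` is locally asymptotically stable at `p`. -/
theorem isLocallyStable_of_contracting {X : Type*} [TopologicalSpace X] {f : X → X} {p : X}
    {N : X → ℝ} {c ε : ℝ} (hc0 : 0 ≤ c) (hc1 : c < 1) (hε : 0 < ε) (hN : ∀ q, 0 ≤ N q)
    (hbasis : (𝓝 p).HasBasis (fun δ : ℝ => 0 < δ) (fun δ => {q | N q < δ}))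
    (hf : ∀ q, N q < ε → N (f q) ≤ c * N q) : IsLocallyStable f p := by
  have key : ∀ q, N q < ε → ∀ k : ℕ, N (f^[k] q) ≤ c ^ k * N q := by
    intro q hq k
    induction k with
    | zero => simp
    | succ k ih =>
      have h1 : c ^ k * N q ≤ N q := mul_le_of_le_one_left (hN q) (pow_le_one₀ hc0 hc1.le)
      rw [Function.iterate_succ_apply']
      calc N (f (f^[k] q)) ≤ c * N (f^[k] q) := hf _ (by linarith)
        _ ≤ c * (c ^ k * N q) := by gcongr
        _ = c ^ (k + 1) * N q := by ring
  constructor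
  · intro U hU
    obtain ⟨δ, hδ, hU⟩ := hbasis.mem_iff.mp hU
    refine ⟨_, hbasis.mem_of_mem (lt_min hδ hε), fun q hq k => hU ?_⟩
    have hq' : N q < min δ ε := hq
    have h1 : c ^ k * N q ≤ N q := mul_le_of_le_one_left (hN q) (pow_le_one₀ hc0 hc1.le)
    have h2 := key q (hq'.trans_le (min_le_right _ _)) k
    exact lt_of_le_of_lt (h2.trans h1) (hq'.trans_le (min_le_left _ _))
  · refine ⟨_, hbasis.mem_of_mem hε, fun q hq => ?_⟩
    rw [hbasis.tendsto_right_iff]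
    intro δ hδ
    have h1 : Tendsto (fun k : ℕ => c ^ k * N q) atTop (𝓝 0) := by
      simpa using (tendsto_pow_atTop_nhds_zero_of_lt_one hc0 hc1).mul_const (N q)
    filter_upwards [h1.eventually_lt_const hδ] with k hk
    exact (key q hq k).trans_lt hk

/-- A map whose second iterate expands, near `p`, a gauge that is bounded near `p` and positive at
points arbitrarily close to `p` is not locally asymptotically stable at `p`. -/
theorem not_isLocallyStable_of_expanding {X : Type*} [TopologicalSpace X] {f : X → X} {p : X}
    {N : X → ℝ} {c B : ℝ} {U : Set X} (hU : U ∈ 𝓝 p) (hc : 1 < c) (hB : ∀ q ∈ U, N q ≤ B)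
    (hpos : ∀ V ∈ 𝓝 p, ∃ q ∈ V, 0 < N q) (hf : ∀ q ∈ U, c * N q ≤ N (f (f q))) :
    ¬ IsLocallyStable f p := by
  rintro ⟨h, -⟩
  obtain ⟨V, hV, hVU⟩ := h U hU
  obtain ⟨q, hqV, hq⟩ := hpos V hV
  have key : ∀ k : ℕ, c ^ k * N q ≤ N (f^[2 * k] q) := by
    intro k
    induction k with
    | zero => simp
    | succ k ih =>
      rw [show 2 * (k + 1) = 2 * k + 1 + 1 by ring, Function.iterate_succ_apply',
        Function.iterate_succ_apply']
      calc c ^ (k + 1) * N q = c * (c ^ k * N q) := by ring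
        _ ≤ c * N (f^[2 * k] q) := by gcongr
        _ ≤ _ := hf _ (hVU q hqV _)
  obtain ⟨k, hk⟩ := pow_unbounded_of_one_lt (B / N q) hc
  rw [div_lt_iff₀ hq] at hk
  linarith [key k, hB _ (hVU q hqV (2 * k))]

theorem kopelMap_sub_fixed {m n : ℝ} {p : ℝ × ℝ} (hp : kopelMap 1 1 m n p = p) (q : ℝ × ℝ) :
    (kopelMap 1 1 m n q).1 - p.1 = m * (1 - 2 * p.2 - (q.2 - p.2)) * (q.2 - p.2) ∧
      (kopelMap 1 1 m n q).2 - p.2 = n * (1 - 2 * p.1 - (q.1 - p.1)) * (q.1 - p.1) := by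
  have h1 := congrArg Prod.fst hp
  have h2 := congrArg Prod.snd hp
  simp only [kopelMap] at h1 h2 ⊢
  constructor
  · linear_combination h1
  · linear_combination h2

theorem nhds_hasBasis_weighted_max (p : ℝ × ℝ) {κ : ℝ} (hκ : 0 < κ) :
    (𝓝 p).HasBasis (fun δ : ℝ => 0 < δ)
      (fun δ => {q | max |q.1 - p.1| (κ * |q.2 - p.2|) < δ}) := by
  refine ⟨fun U => ⟨fun hU => ?_, ?_⟩⟩
  · obtain ⟨ε, hε, h⟩ := Metric.mem_nhds_iff.mp hU
    refine ⟨min ε (κ * ε), lt_min hε (by positivity), fun q hq => h ?_⟩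
    obtain ⟨h1, h2⟩ := max_lt_iff.mp (show max |q.1 - p.1| (κ * |q.2 - p.2|) < _ from hq)
    rw [Metric.mem_ball, Prod.dist_eq, Real.dist_eq, Real.dist_eq]
    exact max_lt (h1.trans_le (min_le_left _ _))
      (lt_of_mul_lt_mul_left (h2.trans_le (min_le_right _ _)) hκ.le)
  · rintro ⟨δ, hδ, h⟩
    refine mem_of_superset (IsOpen.mem_nhds ?_ ?_) h
    · exact isOpen_lt (by fun_prop) continuous_const
    · simpa using hδ

/-- The map exchanges the coordinate deviations with factors at most A and B near p, where only AB <
1 is known. Weighting the second coordinate by κ between A and 1/B turns the factors into A/κ and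
κB, both below 1. -/
theorem isLocallyStable_kopelMap_one {m n : ℝ} {p : ℝ × ℝ} (hm : 0 < m) (hn : 0 < n)
    (hp : kopelMap 1 1 m n p = p) (ht : |m * n * (1 - 2 * p.1) * (1 - 2 * p.2)| < 1) :
    IsLocallyStable (kopelMap 1 1 m n) p := by
  have hF := kopelMap_sub_fixed hp
  set α := |1 - 2 * p.2|
  set β := |1 - 2 * p.1|
  have hα : 0 ≤ α := abs_nonneg _
  have hβ : 0 ≤ β := abs_nonneg _
  have h0 : (m * (α + 0)) * (n * (β + 0)) < 1 := by
    have : |m * n * (1 - 2 * p.1) * (1 - 2 * p.2)| = m * n * β * α := by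
      rw [abs_mul, abs_mul, abs_mul, abs_of_pos hm, abs_of_pos hn]
    rw [this] at ht
    linarith
  obtain ⟨η, hη, hη1⟩ : ∃ η : ℝ, 0 < η ∧ (m * (α + η)) * (n * (β + η)) < 1 := by
    have hcont : ContinuousAt (fun η : ℝ => (m * (α + η)) * (n * (β + η))) 0 := by fun_prop
    have := (hcont.eventually_lt_const h0).filter_mono (nhdsWithin_le_nhds (s := Set.Ioi 0))
    obtain ⟨η, h1, h2⟩ := (this.and self_mem_nhdsWithin).exists
    exact ⟨η, h2, h1⟩
  set A := m * (α + η)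
  set B := n * (β + η)
  have hA : 0 < A := by positivity
  have hB : 0 < B := by positivity
  obtain ⟨κ, hκ1, hκ2⟩ := exists_between (show A < 1 / B by rwa [lt_div_iff₀ hB])
  have hκ : 0 < κ := hA.trans hκ1
  have hκB : κ * B < 1 := by rwa [lt_div_iff₀ hB] at hκ2
  have hAκ : A / κ < 1 := by rwa [div_lt_one hκ]
  refine isLocallyStable_of_contracting (c := max (A / κ) (κ * B)) (ε := min η (κ * η))
    (le_max_of_le_left (by positivity)) (max_lt hAκ hκB) (lt_min hη (by positivity))
    (fun q => le_max_of_le_left (abs_nonneg _)) (nhds_hasBasis_weighted_max p hκ) ?_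
  intro q hq
  obtain ⟨h1, h2⟩ := max_lt_iff.mp hq
  have hu : |q.1 - p.1| < η := h1.trans_le (min_le_left _ _)
  have hv : |q.2 - p.2| < η := lt_of_mul_lt_mul_left (h2.trans_le (min_le_right _ _)) hκ.le
  have e1 : |(kopelMap 1 1 m n q).1 - p.1| ≤ A * |q.2 - p.2| := by
    rw [(hF q).1, abs_mul, abs_mul, abs_of_pos hm]
    gcongr
    exact mul_le_mul_of_nonneg_left
      ((abs_sub (1 - 2 * p.2) (q.2 - p.2)).trans (add_le_add le_rfl hv.le)) hm.le
  have e2 : |(kopelMap 1 1 m n q).2 - p.2| ≤ B * |q.1 - p.1| := by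
    rw [(hF q).2, abs_mul, abs_mul, abs_of_pos hn]
    gcongr
    exact mul_le_mul_of_nonneg_left
      ((abs_sub (1 - 2 * p.1) (q.1 - p.1)).trans (add_le_add le_rfl hu.le)) hn.le
  refine max_le (e1.trans ?_) ?_
  · calc A * |q.2 - p.2| = A / κ * (κ * |q.2 - p.2|) := by field_simp
      _ ≤ _ := by
        gcongr
        · exact le_max_left _ _
        · exact le_max_right _ _
  · calc κ * |(kopelMap 1 1 m n q).2 - p.2| ≤ κ * (B * |q.1 - p.1|) := by gcongr
      _ = κ * B * |q.1 - p.1| := by ring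
      _ ≤ _ := by
        gcongr
        · exact le_max_right _ _
        · exact le_max_left _ _

/-- The second iterate acts on the first coordinate alone, multiplying its deviation by φ, whose
value at `p.1` is the multiplier. So |x - `p.1`| serves as the expanding gauge. -/
theorem not_isLocallyStable_kopelMap_one {m n : ℝ} {p : ℝ × ℝ}
    (hp : kopelMap 1 1 m n p = p) (ht : 1 < |m * n * (1 - 2 * p.1) * (1 - 2 * p.2)|) :
    ¬ IsLocallyStable (kopelMap 1 1 m n) p := by
  have hF := kopelMap_sub_fixed hp
  set φ : ℝ → ℝ := fun x => m * n * (1 - 2 * p.1 - (x - p.1)) *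
    (1 - 2 * p.2 - n * (1 - 2 * p.1 - (x - p.1)) * (x - p.1)) with hφ
  have hFF : ∀ q, (kopelMap 1 1 m n (kopelMap 1 1 m n q)).1 - p.1 = φ q.1 * (q.1 - p.1) := by
    intro q
    rw [(hF _).1, (hF q).2]
    ring
  obtain ⟨c, hc1, hc⟩ := exists_between ht
  have hcont : ContinuousAt (fun q : ℝ × ℝ => |φ q.1|) p := by
    simp only [hφ]; fun_prop
  have hev : ∀ᶠ q in 𝓝 p, c < |φ q.1| :=
    hcont.eventually_const_lt (by simpa [hφ] using hc)
  refine not_isLocallyStable_of_expanding (N := fun q => |q.1 - p.1|) (c := c) (B := 1)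
    (hev.and (Metric.ball_mem_nhds p one_pos)) hc1 ?_ ?_ ?_
  · rintro q ⟨-, hq⟩
    rw [Prod.dist_eq, Real.dist_eq] at hq
    exact (le_max_left _ _).trans hq.le
  · intro V hV
    obtain ⟨ε, hε, h⟩ := Metric.mem_nhds_iff.mp hV
    refine ⟨(p.1 + ε / 2, p.2), h ?_, ?_⟩
    · rw [Metric.mem_ball, Prod.dist_eq]
      simp [abs_of_pos hε, hε]
    · simpa using hε.ne'
  · rintro q ⟨hq, -⟩
    show c * |q.1 - p.1| ≤ |(kopelMap 1 1 m n (kopelMap 1 1 m n q)).1 - p.1|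
    rw [hFF, abs_mul]
    have hq' : c < |φ q.1| := hq
    gcongr

/-- Without multipliers of absolute value one, stability amounts to the Jury conditions. -/
theorem stable_eq_jury {m n : ℝ} (hm : 0 < m) (hn : 0 < n) (hmn : 1 < m * n)
    (h : ∀ x, kopelCubic m n x = 0 → |kopelMultiplier m n x| ≠ 1) :
    stablePositiveEquilibria 1 1 m n = juryPositiveEquilibria 1 1 m n := by
  ext p
  refine and_congr_right fun hp => ?_
  obtain ⟨h1, h2⟩ := (isPositiveEquilibrium_one_iff hn hmn p).mp hp
  have ht : m * n * (1 - 2 * p.1) * (1 - 2 * p.2) = kopelMultiplier m n p.1 := by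
    rw [h2, kopelMultiplier]
  rw [juryConditions_one_iff]
  constructor
  · intro hs
    by_contra! hlt
    exact not_isLocallyStable_kopelMap_one hp.1
      (lt_of_le_of_ne hlt (by rw [ht]; exact (h _ h1).symm)) hs
  · exact isLocallyStable_kopelMap_one hm hn hp.1

theorem mem_jury_iff {m n : ℝ} (hn : 0 < n) (hmn : 1 < m * n) (p : ℝ × ℝ) :
    p ∈ juryPositiveEquilibria 1 1 m n ↔
      (kopelCubic m n p.1 = 0 ∧ |kopelMultiplier m n p.1| < 1) ∧
        p.2 = n * p.1 * (1 - p.1) := by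
  show _ ∧ _ ↔ _
  rw [isPositiveEquilibrium_one_iff hn hmn, juryConditions_one_iff]
  constructor
  · rintro ⟨⟨h1, h2⟩, h3⟩
    exact ⟨⟨h1, by rwa [h2] at h3⟩, h2⟩
  · rintro ⟨⟨h1, h3⟩, h2⟩
    exact ⟨⟨h1, h2⟩, by rwa [h2]⟩

/-! ### Three real roots -/

/-- Vieta's relations for three real roots of `kopelCubic m n`. -/
structure KopelRoots (m n a b c : ℝ) : Prop where
  sum : a + b + c = 2
  sum_mul : n * (a * b + b * c + c * a) = n + 1
  prod : m * n * n * (a * b * c) = m * n - 1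

namespace KopelRoots

variable {m n a b c : ℝ}

theorem swap (h : KopelRoots m n a b c) : KopelRoots m n b a c :=
  ⟨by linarith [h.sum], by linarith [h.sum_mul], by linarith [h.prod]⟩

theorem rotate (h : KopelRoots m n a b c) : KopelRoots m n b c a :=
  ⟨by linarith [h.sum], by linarith [h.sum_mul], by linarith [h.prod]⟩

theorem cubic_eq (h : KopelRoots m n a b c) (x : ℝ) :
    kopelCubic m n x = -(m * n * n) * ((x - a) * (x - b) * (x - c)) := by
  unfold kopelCubic
  linear_combination (-(m * n * n) * x ^ 2) * h.sum + m * n * x * h.sum_mul - h.prod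

theorem cubic_eq_zero_iff (h : KopelRoots m n a b c) (hm : 0 < m) (hn : 0 < n) (x : ℝ) :
    kopelCubic m n x = 0 ↔ x = a ∨ x = b ∨ x = c := by
  have : m * n * n ≠ 0 := by positivity
  rw [h.cubic_eq]
  simp [hm.ne', hn.ne', sub_eq_zero, or_assoc]

theorem one_sub_multiplier (h : KopelRoots m n a b c) :
    1 - kopelMultiplier m n a = m * n * n * a * (a - b) * (a - c) := by
  have h0 : kopelCubic m n a = 0 := by rw [h.cubic_eq]; ring
  have h1 := h.sum
  have h2 := h.sum_mul
  obtain rfl : c = 2 - a - b := by linarith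
  unfold kopelCubic at h0
  unfold kopelMultiplier
  linear_combination -h0 - m * n * a * h2

/-- Expresses m and n rationally in the roots, so that the identities below become polynomial
identities in a and b once denominators are cleared and c = 2 - a - b. -/
theorem exists_param (h : KopelRoots m n a b c) :
    ∃ D E, D = a * b + b * c + c * a - 1 ∧ E = a * b + b * c + c * a - 1 - a * b * c ∧
      D ≠ 0 ∧ E ≠ 0 ∧ n = 1 / D ∧ m = D ^ 2 / E := by
  refine ⟨_, _, rfl, rfl, ?_⟩
  have hD : n * (a * b + b * c + c * a - 1) = 1 := by linarith [h.sum_mul]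
  have hD0 : a * b + b * c + c * a - 1 ≠ 0 := right_ne_zero_of_mul (by rw [hD]; exact one_ne_zero)
  have hE : m * n * n * (a * b + b * c + c * a - 1 - a * b * c) = 1 := by
    linear_combination m * n * hD - h.prod
  have hE0 := right_ne_zero_of_mul (by rw [hE]; exact one_ne_zero)
  refine ⟨hD0, hE0, by rwa [eq_div_iff hD0], ?_⟩
  rw [eq_div_iff hE0]
  linear_combination (a * b + b * c + c * a - 1) ^ 2 * hE -
    m * (a * b + b * c + c * a - 1 - a * b * c) *
      (n * (a * b + b * c + c * a - 1) + 1) * hD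

theorem polyR₁_eq (h : KopelRoots m n a b c) :
    polyR₁ m n = (m * n * n * ((a - b) * (a - c) * (b - c))) ^ 2 := by
  have h1 := h.sum
  obtain ⟨D, E, eD, eE, hD, hE, rfl, rfl⟩ := h.exists_param
  obtain rfl : c = 2 - a - b := by linarith
  clear h h1
  unfold polyR₁
  field_simp
  subst eE eD
  ring

theorem polyS₃_eq (h : KopelRoots m n a b c) :
    polyS₃ m n = (1 + kopelMultiplier m n a) * (1 + kopelMultiplier m n b) *
      (1 + kopelMultiplier m n c) := by
  rw [show 1 + kopelMultiplier m n a = 2 - m * n * n * a * (a - b) * (a - c) by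
      linarith [h.one_sub_multiplier],
    show 1 + kopelMultiplier m n b = 2 - m * n * n * b * (b - c) * (b - a) by
      linarith [h.rotate.one_sub_multiplier],
    show 1 + kopelMultiplier m n c = 2 - m * n * n * c * (c - a) * (c - b) by
      linarith [h.rotate.rotate.one_sub_multiplier]]
  have h1 := h.sum
  obtain ⟨D, E, eD, eE, hD, hE, rfl, rfl⟩ := h.exists_param
  obtain rfl : c = 2 - a - b := by linarith
  clear h h1
  unfold polyS₃
  field_simp
  subst eE eD
  ring

theorem polyA₁_eq (h : KopelRoots m n a b c) :
    -polyA₁ m n = (1 + kopelMultiplier m n a) + (1 + kopelMultiplier m n b) +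
      (1 + kopelMultiplier m n c) := by
  rw [show 1 + kopelMultiplier m n a = 2 - m * n * n * a * (a - b) * (a - c) by
      linarith [h.one_sub_multiplier],
    show 1 + kopelMultiplier m n b = 2 - m * n * n * b * (b - c) * (b - a) by
      linarith [h.rotate.one_sub_multiplier],
    show 1 + kopelMultiplier m n c = 2 - m * n * n * c * (c - a) * (c - b) by
      linarith [h.rotate.rotate.one_sub_multiplier]]
  have h1 := h.sum
  obtain ⟨D, E, eD, eE, hD, hE, rfl, rfl⟩ := h.exists_param
  obtain rfl : c = 2 - a - b := by linarith
  clear h h1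
  unfold polyA₁
  field_simp
  subst eE eD
  ring

/-- The second leading minor of the Hermite quadratic form of `kopelCubic` weighted by
`1 + kopelMultiplier`. -/
theorem polyA₂_eq (h : KopelRoots m n a b c) :
    4 * polyA₂ m n = n *
      ((1 + kopelMultiplier m n a) * (1 + kopelMultiplier m n b) * (a - b) ^ 2 +
      (1 + kopelMultiplier m n b) * (1 + kopelMultiplier m n c) * (b - c) ^ 2 +
      (1 + kopelMultiplier m n a) * (1 + kopelMultiplier m n c) * (a - c) ^ 2) := by
  rw [show 1 + kopelMultiplier m n a = 2 - m * n * n * a * (a - b) * (a - c) by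
      linarith [h.one_sub_multiplier],
    show 1 + kopelMultiplier m n b = 2 - m * n * n * b * (b - c) * (b - a) by
      linarith [h.rotate.one_sub_multiplier],
    show 1 + kopelMultiplier m n c = 2 - m * n * n * c * (c - a) * (c - b) by
      linarith [h.rotate.rotate.one_sub_multiplier]]
  have h1 := h.sum
  obtain ⟨D, E, eD, eE, hD, hE, rfl, rfl⟩ := h.exists_param
  obtain rfl : c = 2 - a - b := by linarith
  clear h h1
  unfold polyA₂
  field_simp
  subst eE eD
  ring

end KopelRoots

/-- If the extreme weights are negative, then the weighted Hermite form has a nonpositive leading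
minor. -/
theorem hermite_minor_nonpos {a b c u v w : ℝ} (hu : u < 0) (hw : w < 0)
    (hsum : 0 < u + v + w) :
    u * v * (a - b) ^ 2 + v * w * (b - c) ^ 2 + u * w * (a - c) ^ 2 ≤ 0 := by
  have hS : 0 ≤ (-u) * (a - b) ^ 2 + (-w) * (b - c) ^ 2 := by
    have : 0 ≤ -u := by linarith
    have : 0 ≤ -w := by linarith
    positivity
  -- With p = a - b, q = b - c and S the sum in `hS`, the minor equals -(u + v + w)S - (up - wq)².
  have h1 := mul_nonneg hsum.le hS
  nlinarith [sq_nonneg (u * (a - b) - w * (b - c))]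

/-! ### Number of real roots -/

/-- Here s is the product of the other two roots, real or not, whose sum is 2 - r. -/
theorem exists_quadratic_factor {m n r : ℝ} (hn : 0 < n) (hr : kopelCubic m n r = 0) :
    ∃ s, n * (s + r * (2 - r)) = n + 1 ∧ m * n * n * (r * s) = m * n - 1 := by
  refine ⟨(n + 1) / n - r * (2 - r), by field_simp; ring, ?_⟩
  unfold kopelCubic at hr
  field_simp
  linear_combination -hr

theorem exists_kopelRoots_of_discr_nonneg {m n r s : ℝ}
    (h1 : n * (s + r * (2 - r)) = n + 1) (h2 : m * n * n * (r * s) = m * n - 1)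
    (hE : s ≤ ((2 - r) / 2) ^ 2) : ∃ b c, KopelRoots m n r b c := by
  have hsq := Real.sq_sqrt (sub_nonneg.mpr hE)
  set e := √(((2 - r) / 2) ^ 2 - s)
  have hs : ((2 - r) / 2 + e) * ((2 - r) / 2 - e) = s := by linear_combination -hsq
  refine ⟨(2 - r) / 2 + e, (2 - r) / 2 - e, by ring, ?_, ?_⟩
  · linear_combination h1 + n * hs
  · linear_combination h2 + m * n * n * r * hs

/-- The factorization of the cubic, its discriminant and the norm of `1 + kopelMultiplier` when
one root is `r` and the others have sum `2 - r` and product `s`. -/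
theorem complex_pair_identities {m n r s : ℝ}
    (h1 : n * (s + r * (2 - r)) = n + 1) (h2 : m * n * n * (r * s) = m * n - 1) :
    1 - kopelMultiplier m n r = m * n * n * r * (3 * r ^ 2 - 4 * r + (s + r * (2 - r))) ∧
    polyR₁ m n = -4 * (s - ((2 - r) / 2) ^ 2) *
      (m * n * n * (3 * r ^ 2 - 4 * r + (s + r * (2 - r)))) ^ 2 ∧
    polyS₃ m n = (1 + kopelMultiplier m n r) *
      ((2 + 2 * (m * n * n) * (s - ((2 - r) / 2) ^ 2) * (2 - 2 * r)) ^ 2 +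
        4 * (m * n * n) ^ 2 * (s - ((2 - r) / 2) ^ 2) *
          ((2 - r) / 2 * ((2 - r) / 2 - r) - (s - ((2 - r) / 2) ^ 2)) ^ 2) := by
  -- When s - ((2 - r)/2)² is positive, it is the squared imaginary part of the complex pair z, z̄.
  -- The factor 3r² - 4r + ⋯ is (r - z)(r - z̄), and the bracket in the last identity is |1 +
  -- t(z)|², split into real and imaginary parts.
  have hD : n * (s - (1 - r) ^ 2) = 1 := by linear_combination h1
  have hD0 : s - (1 - r) ^ 2 ≠ 0 := right_ne_zero_of_mul (by rw [hD]; exact one_ne_zero)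
  have hE : m * n * n * (s - (1 - r) ^ 2 - r * s) = 1 := by
    linear_combination m * n * hD - h2
  have hE0 := right_ne_zero_of_mul (by rw [hE]; exact one_ne_zero)
  obtain ⟨D, eD⟩ : ∃ D, D = s - (1 - r) ^ 2 := ⟨_, rfl⟩
  obtain ⟨E, eE⟩ : ∃ E, E = s - (1 - r) ^ 2 - r * s := ⟨_, rfl⟩
  rw [← eE] at hE hE0
  rw [← eD] at hD hD0
  obtain rfl : n = 1 / D := by rwa [eq_div_iff hD0]
  obtain rfl : m = D ^ 2 / E := by
    rw [eq_div_iff hE0]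
    field_simp at hE
    linear_combination hE
  unfold polyS₃ polyR₁ kopelMultiplier
  clear h1 h2 hD hE
  refine ⟨?_, ?_, ?_⟩
  · field_simp
    subst eE eD
    ring
  · field_simp
    subst eE eD
    ring
  · field_simp
    subst eE eD
    ring

/-- If mn ≤ 1, then R₁ < 1 + 18 - 27 < 0. This supplies mn > 1 in part (a), where it is not assumed.
-/
theorem one_lt_mul_of_polyR₁_pos {m n : ℝ} (hm : 0 < m) (hn : 0 < n) (h : 0 < polyR₁ m n) :
    1 < m * n := by
  by_contra! hp
  have h0 : 0 < m * n := by positivity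
  have h1 : 0 < m * n * (m + n) := by positivity
  have h2 : (m * n) ^ 2 ≤ 1 := pow_le_one₀ h0.le hp
  unfold polyR₁ at h
  nlinarith

theorem KopelRoots.exists_sorted {m n a b c : ℝ} (h : KopelRoots m n a b c)
    (hab : a ≠ b) (hac : a ≠ c) (hbc : b ≠ c) :
    ∃ a b c, KopelRoots m n a b c ∧ a < b ∧ b < c := by
  rcases lt_or_gt_of_ne hab with h1 | h1 <;> rcases lt_or_gt_of_ne hac with h2 | h2 <;>
    rcases lt_or_gt_of_ne hbc with h3 | h3
  · exact ⟨a, b, c, h, h1, h3⟩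
  · exact ⟨a, c, b, h.rotate.rotate.swap, h2, h3⟩
  · linarith
  · exact ⟨c, a, b, h.rotate.rotate, h2, h1⟩
  · exact ⟨b, a, c, h.swap, h1, h2⟩
  · linarith
  · exact ⟨b, c, a, h.rotate, h3, h2⟩
  · exact ⟨c, b, a, h.swap.rotate.rotate, h3, h1⟩

theorem exists_sorted_roots_of_polyR₁_pos {m n : ℝ} (hn : 0 < n) (hmn : 1 < m * n)
    (hR : 0 < polyR₁ m n) : ∃ a b c, KopelRoots m n a b c ∧ a < b ∧ b < c := by
  obtain ⟨r, hr⟩ := exists_kopelCubic_root hmn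
  obtain ⟨s, h1, h2⟩ := exists_quadratic_factor hn hr
  obtain ⟨-, hR', -⟩ := complex_pair_identities h1 h2
  obtain ⟨b, c, h⟩ : ∃ b c, KopelRoots m n r b c := by
    refine exists_kopelRoots_of_discr_nonneg h1 h2 ?_
    by_contra! hE
    have := mul_nonneg (sub_nonneg.mpr hE.le)
      (sq_nonneg (m * n * n * (3 * r ^ 2 - 4 * r + (s + r * (2 - r)))))
    linarith
  have hR2 := h.polyR₁_eq
  refine h.exists_sorted ?_ ?_ ?_ <;> rintro rfl <;> simp at hR2 <;> linarith

theorem KopelRoots.multiplier_sorted {m n a b c : ℝ} (hm : 0 < m) (hn : 0 < n)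
    (hmn : 1 < m * n) (h : KopelRoots m n a b c) (hab : a < b) (hbc : b < c) :
    kopelMultiplier m n a < 1 ∧ 1 < kopelMultiplier m n b ∧ kopelMultiplier m n c < 1 := by
  have hpos : ∀ x, x = a ∨ x = b ∨ x = c → 0 < x := fun x hx =>
    (kopelCubic_root_mem_Ioo hn hmn ((h.cubic_eq_zero_iff hm hn x).mpr hx)).1
  have ha := hpos a (by simp)
  have hb := hpos b (by simp)
  have hc := hpos c (by simp)
  have ea := h.one_sub_multiplier
  have eb := h.rotate.one_sub_multiplier
  have ec := h.rotate.rotate.one_sub_multiplier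
  have d1 : 0 < b - a := sub_pos.mpr hab
  have d2 : 0 < c - b := sub_pos.mpr hbc
  have d3 : 0 < c - a := by linarith
  have pa : 0 < m * n * n * a * (b - a) * (c - a) := by positivity
  have pb : 0 < m * n * n * b * (c - b) * (b - a) := by positivity
  have pc : 0 < m * n * n * c * (c - a) * (c - b) := by positivity
  refine ⟨?_, ?_, ?_⟩ <;> linarith

/-! ### Counting the equilibria that satisfy the Jury conditions -/

theorem existsUnique_mem_jury {m n x : ℝ} (hn : 0 < n) (hmn : 1 < m * n)
    (h : ∀ z, kopelCubic m n z = 0 ∧ |kopelMultiplier m n z| < 1 ↔ z = x) :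
    ∃! p, p ∈ juryPositiveEquilibria 1 1 m n := by
  simp only [mem_jury_iff hn hmn, h]
  refine ⟨(x, n * x * (1 - x)), ⟨rfl, rfl⟩, ?_⟩
  rintro ⟨x', y'⟩ ⟨h1, h2⟩
  simp only at h1 h2
  rw [h2, h1]

/-- Three equilibria, of which both outer ones are stable. -/
theorem jury_ncard_eq_two {m n : ℝ} (hm : 0 < m) (hn : 0 < n) (hR : 0 < polyR₁ m n)
    (hS : 0 < polyS₃ m n) (hA₁ : polyA₁ m n < 0) (hA₂ : 0 < polyA₂ m n) :
    (juryPositiveEquilibria 1 1 m n).ncard = 2 ∧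
      ∀ x, kopelCubic m n x = 0 → |kopelMultiplier m n x| ≠ 1 := by
  have hmn := one_lt_mul_of_polyR₁_pos hm hn hR
  obtain ⟨a, b, c, h, hab, hbc⟩ := exists_sorted_roots_of_polyR₁_pos hn hmn hR
  obtain ⟨ta, tb, tc⟩ := h.multiplier_sorted hm hn hmn hab hbc
  have hb : 0 < 1 + kopelMultiplier m n b := by linarith
  have hac : 0 < (1 + kopelMultiplier m n a) * (1 + kopelMultiplier m n c) := by
    rw [h.polyS₃_eq, mul_right_comm] at hS
    exact pos_of_mul_pos_left hS hb.le
  have hsum := h.polyA₁_eq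
  have hminor := h.polyA₂_eq
  obtain ⟨ha, hc⟩ : 0 < 1 + kopelMultiplier m n a ∧ 0 < 1 + kopelMultiplier m n c := by
    rcases pos_and_pos_or_neg_and_neg_of_mul_pos hac with h' | ⟨ha, hc⟩
    · exact h'
    -- Both outer weights negative: A₁ < 0 makes the sum of the weights positive, so the Hermite
    -- minor is nonpositive, against A₂ > 0.
    · have := mul_nonpos_of_nonneg_of_nonpos hn.le
        (hermite_minor_nonpos (a := a) (b := b) (c := c) (v := 1 + kopelMultiplier m n b)
          ha hc (by linarith))
      linarith
  have haa : |kopelMultiplier m n a| < 1 := abs_lt.mpr ⟨by linarith, ta⟩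
  have hbb : 1 < |kopelMultiplier m n b| := tb.trans_le (le_abs_self _)
  have hcc : |kopelMultiplier m n c| < 1 := abs_lt.mpr ⟨by linarith, tc⟩
  constructor
  · have : juryPositiveEquilibria 1 1 m n =
        {(a, n * a * (1 - a)), (c, n * c * (1 - c))} := by
      ext ⟨x, y⟩
      simp only [mem_jury_iff hn hmn, h.cubic_eq_zero_iff hm hn, Set.mem_insert_iff,
        Set.mem_singleton_iff, Prod.mk.injEq]
      constructor
      · rintro ⟨⟨rfl | rfl | rfl, ht⟩, hy⟩
        · exact Or.inl ⟨rfl, hy⟩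
        · linarith
        · exact Or.inr ⟨rfl, hy⟩
      · rintro (⟨rfl, rfl⟩ | ⟨rfl, rfl⟩)
        · exact ⟨⟨by simp, haa⟩, rfl⟩
        · exact ⟨⟨by simp, hcc⟩, rfl⟩
    rw [this, Set.ncard_pair]
    intro he
    have := congrArg Prod.fst he
    simp only at this
    linarith
  · intro x hx
    rcases (h.cubic_eq_zero_iff hm hn x).mp hx with rfl | rfl | rfl
    exacts [haa.ne, hbb.ne', hcc.ne]

/-- Three equilibria, of which exactly one outer one is stable. -/
theorem existsUnique_jury_of_polyS₃_neg {m n : ℝ} (hm : 0 < m) (hn : 0 < n)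
    (hR : 0 < polyR₁ m n) (hS : polyS₃ m n < 0) :
    (∃! p, p ∈ juryPositiveEquilibria 1 1 m n) ∧
      ∀ x, kopelCubic m n x = 0 → |kopelMultiplier m n x| ≠ 1 := by
  have hmn := one_lt_mul_of_polyR₁_pos hm hn hR
  obtain ⟨a, b, c, h, hab, hbc⟩ := exists_sorted_roots_of_polyR₁_pos hn hmn hR
  obtain ⟨ta, tb, tc⟩ := h.multiplier_sorted hm hn hmn hab hbc
  have hb : 0 < 1 + kopelMultiplier m n b := by linarith
  have hac : (1 + kopelMultiplier m n a) * (1 + kopelMultiplier m n c) < 0 := by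
    rw [h.polyS₃_eq, mul_right_comm] at hS
    exact neg_of_mul_neg_left hS hb.le
  have hbb : 1 < |kopelMultiplier m n b| := tb.trans_le (le_abs_self _)
  rcases mul_neg_iff.mp hac with ⟨ha, hc⟩ | ⟨ha, hc⟩
  · have haa : |kopelMultiplier m n a| < 1 := abs_lt.mpr ⟨by linarith, ta⟩
    have hcc : 1 < |kopelMultiplier m n c| := lt_abs.mpr (Or.inr (by linarith))
    refine ⟨existsUnique_mem_jury (x := a) hn hmn fun z => ?_, fun x hx => ?_⟩
    · rw [h.cubic_eq_zero_iff hm hn]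
      constructor
      · rintro ⟨rfl | rfl | rfl, ht⟩
        exacts [rfl, absurd ht hbb.not_gt, absurd ht hcc.not_gt]
      · rintro rfl
        exact ⟨Or.inl rfl, haa⟩
    · rcases (h.cubic_eq_zero_iff hm hn x).mp hx with rfl | rfl | rfl
      exacts [haa.ne, hbb.ne', hcc.ne']
  · have hcc : |kopelMultiplier m n c| < 1 := abs_lt.mpr ⟨by linarith, tc⟩
    have haa : 1 < |kopelMultiplier m n a| := lt_abs.mpr (Or.inr (by linarith))
    refine ⟨existsUnique_mem_jury (x := c) hn hmn fun z => ?_, fun x hx => ?_⟩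
    · rw [h.cubic_eq_zero_iff hm hn]
      constructor
      · rintro ⟨rfl | rfl | rfl, ht⟩
        exacts [absurd ht haa.not_gt, absurd ht hbb.not_gt, rfl]
      · rintro rfl
        exact ⟨Or.inr (Or.inr rfl), hcc⟩
    · rcases (h.cubic_eq_zero_iff hm hn x).mp hx with rfl | rfl | rfl
      exacts [haa.ne', hbb.ne', hcc.ne]

/-- A single equilibrium, which is stable. -/
theorem existsUnique_jury_of_polyR₁_neg {m n : ℝ} (hm : 0 < m) (hn : 0 < n) (hmn : 1 < m * n)
    (hR : polyR₁ m n < 0) (hS : 0 < polyS₃ m n) :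
    (∃! p, p ∈ juryPositiveEquilibria 1 1 m n) ∧
      ∀ x, kopelCubic m n x = 0 → |kopelMultiplier m n x| ≠ 1 := by
  obtain ⟨r, hr⟩ := exists_kopelCubic_root hmn
  obtain ⟨s, h1, h2⟩ := exists_quadratic_factor hn hr
  obtain ⟨ht, hR', hS'⟩ := complex_pair_identities h1 h2
  have hE : 0 < s - ((2 - r) / 2) ^ 2 := by
    rw [sub_pos]
    by_contra! hle
    obtain ⟨b, c, h⟩ := exists_kopelRoots_of_discr_nonneg h1 h2 hle
    rw [h.polyR₁_eq] at hR
    exact absurd hR (sq_nonneg _).not_gt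
  have hr0 := (kopelCubic_root_mem_Ioo hn hmn hr).1
  have hq : ∀ x, 0 < x ^ 2 + (r - 2) * x + s := by
    intro x
    linarith [sq_nonneg (x - (2 - r) / 2)]
  have hlt : kopelMultiplier m n r < 1 := by
    have : 0 < m * n * n * r * (r ^ 2 + (r - 2) * r + s) := mul_pos (by positivity) (hq r)
    linarith
  have hgt : 0 < 1 + kopelMultiplier m n r := by
    rw [hS'] at hS
    exact pos_of_mul_pos_left hS (by positivity)
  have habs : |kopelMultiplier m n r| < 1 := abs_lt.mpr ⟨by linarith, hlt⟩
  have huniq : ∀ z, kopelCubic m n z = 0 → z = r := by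
    intro z hz
    have hfac : (m * n * n * (z ^ 2 + (r - 2) * z + s)) * (z - r) = 0 := by
      unfold kopelCubic at hz
      linear_combination -hz + m * n * z * h1 - h2
    have : m * n * n * (z ^ 2 + (r - 2) * z + s) ≠ 0 := (mul_pos (by positivity) (hq z)).ne'
    exact sub_eq_zero.mp ((mul_eq_zero.mp hfac).resolve_left this)
  refine ⟨existsUnique_mem_jury (x := r) hn hmn fun z => ⟨fun hz => huniq z hz.1, ?_⟩, ?_⟩
  · rintro rfl
    exact ⟨hr, habs⟩
  · intro x hx
    rw [huniq x hx]
    exact habs.ne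

theorem theorem4 (μ₁ μ₂ : ℝ) (hμ₁ : 0 < μ₁) (hμ₂ : 0 < μ₂) :
    (0 < polyR₁ μ₁ μ₂ → 0 < polyS₃ μ₁ μ₂ → polyA₁ μ₁ μ₂ < 0 → 0 < polyA₂ μ₁ μ₂ →
      (stablePositiveEquilibria 1 1 μ₁ μ₂).ncard = 2 ∧
        stablePositiveEquilibria 1 1 μ₁ μ₂ = juryPositiveEquilibria 1 1 μ₁ μ₂) ∧
    (1 < μ₁ * μ₂ →
      (polyR₁ μ₁ μ₂ < 0 ∧ 0 < polyS₃ μ₁ μ₂) ∨ (0 < polyR₁ μ₁ μ₂ ∧ polyS₃ μ₁ μ₂ < 0) →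
      (∃! p : ℝ × ℝ, p ∈ stablePositiveEquilibria 1 1 μ₁ μ₂) ∧
        stablePositiveEquilibria 1 1 μ₁ μ₂ = juryPositiveEquilibria 1 1 μ₁ μ₂) := by
  constructor
  · intro hR hS hA₁ hA₂
    obtain ⟨hcard, ht⟩ := jury_ncard_eq_two hμ₁ hμ₂ hR hS hA₁ hA₂
    have heq := stable_eq_jury hμ₁ hμ₂ (one_lt_mul_of_polyR₁_pos hμ₁ hμ₂ hR) ht
    exact ⟨heq ▸ hcard, heq⟩
  · intro hmn h
    obtain ⟨hex, ht⟩ : (∃! p, p ∈ juryPositiveEquilibria 1 1 μ₁ μ₂) ∧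
        ∀ x, kopelCubic μ₁ μ₂ x = 0 → |kopelMultiplier μ₁ μ₂ x| ≠ 1 := by
      rcases h with ⟨hR, hS⟩ | ⟨hR, hS⟩
      · exact existsUnique_jury_of_polyR₁_neg hμ₁ hμ₂ hmn hR hS
      · exact existsUnique_jury_of_polyS₃_neg hμ₁ hμ₂ hR hS
    have heq := stable_eq_jury hμ₁ hμ₂ hmn ht
    exact ⟨heq ▸ hex, heq⟩
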